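/- Setting. There are $K\ge 2$ arms $a_1,\dots,a_K$, a time horizon $T\ge 2$, and changepoints $1=\nu_0<\nu_1<\dots<\nu_{M-1}<\nu_M=T+1$ dividing $\{1,\dots,T\}$ into $M$ segments $S_m=\{\nu_{m-1},\dots,\nu_m-1\}$. Segment $m$ has a preference matrix $P^{(m)}=(p^{(m)}_{i,j})\in[0,1]^{K\times K}$ with $p^{(m)}_{i,j}+p^{(m)}_{j,i}=1$ and a Condorcet winner $a_{m^*}$, i.e. $p^{(m)}_{m^*,i}>\frac12$ for all $i\ne m^*$. If the pair $(a_I,a_J)$ is played at a time $t\in S_m$, then $a_I$ wins with probability $p^{(m)}_{I,J}$, independently of everything else given the choice of the pair, and the binary weak regret is $\lceil\min\{p^{(m)}_{m^*,I}-\frac12,\;p^{(m)}_{m^*,J}-\frac12\}\rceil$; $R^{\bar{\mathrm W}}(T)$ is the sum of these regrets over $t=1,\dots,T$. Let $\delta_*^{(m)}=\max_j|p^{(m+1)}_{m^*,j}-p^{(m)}_{m^*,j}|$ and $\delta_*=\min_{1\le m\le M-1}\delta_*^{(m)}$ (if $M=1$, let $\delta_*$ be any number in $(0,1]$), and assume $\delta_*>0$.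 Algorithm. Let $Alg$ be any (possibly randomized) dueling bandits algorithm that can report a suspected Condorcet winner at any time, and let $\tilde T\ge 0$ be an integer. DETECT with cap $\tilde T$, even window length $w$ and threshold $b>0$ works in cycles until the time horizon $T$ is reached. In each cycle it runs a fresh instance of $Alg$ for $\tilde T$ time steps and takes its suspected Condorcet winner $a_I$. It then plays the pairs $(a_I,a_j)$, $j\ne I$, cyclically in some fixed order, keeping for each $j$ the outcomes of the duels between $a_I$ and $a_j$ in this cycle. As soon as the pair just played has at least $w$ such outcomes, and among its last $w$ outcomes the numbers of wins of $a_I$ in the older and in the newer half differ by more than $b$, the cycle ends and a new one starts in the next time step. Let $p_{\tilde T}$ be any number such that, for every $m\le M$, $Alg$ run for $\tilde T$ steps in the stationary environment $P^{(m)}$ reports $a_{m^*}$ with probability at least $p_{\tilde T}$. Let $$R_M^{\bar{\mathrm W}}(Alg)=\sum_{m=1}^M\mathbb E\big[\tilde R^{\bar{\mathrm W}}(\nu_{m-1},\nu_{m-1}+\tilde T-1)\big],$$ where $\tilde R^{\bar{\mathrm W}}(t_1,t_2)$ is the cumulative binary weak regret that $Alg$ incurs when started at time $t_1$ and run on its own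 up to time $t_2$. Claim. Let $w$ be the lowest even integer $\ge 32\log T/\delta_*^2$, let $b=\sqrt{2w\log T}$ and $c=\sqrt{8\log T/w}$, and assume $|S_m|\ge\tilde T+\frac32w(K-1)$ for all $m\le M$. Then $b,c>0$ and $\delta_*\ge\frac{2b}{w}+c$, and the expected cumulative binary weak regret of DETECT satisfies $$\mathbb E\big[R^{\bar{\mathrm W}}(T)\big]\le C\,\frac{KM\log T}{\delta_*^2}+(1-p_{\tilde T})MT+R_M^{\bar{\mathrm W}}(Alg)$$ with a universal constant $C>0$, independent of $K,M,T$, the environment, $Alg$, $\tilde T$, $p_{\tilde T}$ and $\delta_*$. -/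

import Mathlib

noncomputable section

namespace DuelingBandits

/-- An ordered pair `(a_I, a_J)` of arms that is played in one time step. -/
abbrev ArmPair (K : ℕ) : Type := Fin K × Fin K

/-- A duel: the pair `(a_I, a_J)` that was played and its outcome, `true` if and only if
`a_I` has won against `a_J`. -/
abbrev Duel (K : ℕ) : Type := ArmPair K × Bool

/-- The Bernoulli distribution with success probability `p` on `Bool`. -/
def bernoulli (p : unitInterval) : PMF Bool :=
  PMF.ofFintype (fun x => ENNReal.ofReal (if x then (p : ℝ) else 1 - (p : ℝ))) (by
    have h0 : (0 : ℝ) ≤ p := p.2.1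
    have h1 : (0 : ℝ) ≤ 1 - (p : ℝ) := sub_nonneg.mpr p.2.2
    simp only [Fintype.sum_bool, if_true, Bool.false_eq_true, if_false]
    rw [← ENNReal.ofReal_add h0 h1]
    simp)

/-- The expected value of `f` under the discrete probability distribution `μ`. It is only applied
to distributions of finite support. -/
def expect {α : Type} (μ : PMF α) (f : α → ℝ) : ℝ := ∑' a, (μ a).toReal * f a

/-! ### The environment -/

/-- An instance of the non-stationary dueling bandits problem with `K` arms, time horizon `T`
and `M` stationary segments. The values `ν m` for `m > M`, `P m` and `star m` for `m = 0` or
`m > M` are irrelevant. -/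
structure Environment (K M T : ℕ) where
  /-- The changepoints `1 = ν 0 < ν 1 < … < ν M = T + 1`;
  segment `m` is `{ν (m - 1), …, ν m - 1}` for `1 ≤ m ≤ M`. -/
  ν : ℕ → ℕ
  ν_zero : ν 0 = 1
  ν_last : ν M = T + 1
  ν_lt : ∀ m, m < M → ν m < ν (m + 1)
  /-- `P m i j` is the probability that `a_i` wins against `a_j` in segment `m`. -/
  P : ℕ → Fin K → Fin K → unitInterval
  P_add : ∀ m, 1 ≤ m → m ≤ M → ∀ i j, (P m i j : ℝ) + (P m j i : ℝ) = 1
  /-- The index of the Condorcet winner of segment `m`. -/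
  star : ℕ → Fin K
  star_beats : ∀ m, 1 ≤ m → m ≤ M → ∀ i, i ≠ star m → (1 / 2 : ℝ) < (P m (star m) i : ℝ)

namespace Environment

variable {K M T : ℕ} (E : Environment K M T)

/-- The index of the segment that contains time step `t`: one plus the number of
changepoints among `ν 1, …, ν (M - 1)` that are at most `t`. -/
def seg (t : ℕ) : ℕ := 1 + ((Finset.Icc 1 (M - 1)).filter fun m => E.ν m ≤ t).card

/-- The preference matrix that governs time step `t`. -/
def prefAt (t : ℕ) : Fin K → Fin K → unitInterval := E.P (E.seg t)

/-- The suboptimality gap `Δ_i = P (m*, i) - 1/2` of arm `i` in segment `m`. -/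
def gap (m : ℕ) (i : Fin K) : ℝ := (E.P m (E.star m) i : ℝ) - 1 / 2

/-- The instantaneous weak regret of a pair in segment `m`. -/
def weakRegret (m : ℕ) (d : ArmPair K) : ℝ := min (E.gap m d.1) (E.gap m d.2)

/-- The instantaneous binary weak regret of a pair in segment `m`. -/
def binWeakRegret (m : ℕ) (d : ArmPair K) : ℝ := (⌈E.weakRegret m d⌉ : ℤ)

/-- The cumulative binary weak regret of a sequence of pairs that is played from time step `s`
on. The list has the most recent pair first, so its last entry is played at time `s`. -/
def cumRegret (s : ℕ) : List (ArmPair K) → ℝ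
  | [] => 0
  | d :: h => E.binWeakRegret (E.seg (s + h.length)) d + cumRegret s h

/-- The change `max_j |P^(m+1) (m*, j) - P^(m) (m*, j)|` at the changepoint `ν m` of the
preferences of the Condorcet winner `m*` of segment `m`. -/
def segChange (m : ℕ) : ℝ :=
  ⨆ j : Fin K, |(E.P (m + 1) (E.star m) j : ℝ) - (E.P m (E.star m) j : ℝ)|

/-- `δ` is the minimal segmental change `δ_*`: the minimum of `segChange m` over the changepoints
`1 ≤ m ≤ M - 1`. If there is no changepoint, any number in `(0, 1]` is admitted. -/
def IsMinSegChange (δ : ℝ) : Prop :=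
  if M ≤ 1 then 0 < δ ∧ δ ≤ 1 else IsLeast (E.segChange '' Set.Icc 1 (M - 1)) δ

end Environment

/-! ### The black-box algorithm -/

/-- A (possibly randomized) dueling bandits algorithm that reports a suspected Condorcet winner.
It is given by the conditional laws of its next pair and of its suspected Condorcet winner
given the duels (most recent first) that it has played since it was last (re)started. -/
structure BlackBox (K : ℕ) where
  /-- The law of the next pair. -/
  select : List (Duel K) → PMF (ArmPair K)
  /-- The law of the suspected Condorcet winner. -/
  suspect : List (Duel K) → PMF (Fin K)

namespace BlackBox

variable {K : ℕ} (A : BlackBox K)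

/-- One time step of the algorithm with history `h` under the preference matrix `Q`: the law of
the duel that is played. -/
def duel (Q : Fin K → Fin K → unitInterval) (h : List (Duel K)) : PMF (Duel K) :=
  (A.select h).bind fun d => (bernoulli (Q d.1 d.2)).map fun x => (d, x)

/-- The law of the first `n` duels (most recent first) of the algorithm when it is run on its own
from time step `s` on, where `Q t` is the preference matrix of time step `t`. -/
def run (Q : ℕ → Fin K → Fin K → unitInterval) (s : ℕ) : ℕ → PMF (List (Duel K))
  | 0 => PMF.pure []
  | n + 1 => (run Q s n).bind fun h => (A.duel (Q (s + n)) h).map fun x => x :: h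

/-- The probability that the suspected Condorcet winner after `n` time steps is `a_i`, if the
algorithm is run in the stationary setting with preference matrix `Q`. -/
def suspectProb (Q : Fin K → Fin K → unitInterval) (n : ℕ) (i : Fin K) : ℝ :=
  (((A.run (fun _ => Q) 1 n).bind A.suspect) i).toReal

/-- The expected cumulative binary weak regret of the algorithm when it is run on its own for the
`n` time steps `s, …, s + n - 1`. -/
def expRegret {M T : ℕ} (E : Environment K M T) (s n : ℕ) : ℝ :=
  expect (A.run E.prefAt s n) fun h => E.cumRegret s (h.map Prod.fst)

end BlackBox

/-! ### DETECT -/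

/-- The orderings that DETECT uses: `arm τ I r` with `r < K - 1` is the `r`-th arm (counting from
zero) in the ordering of the arms other than `a_I` that is used if `a_I` is the suspected
Condorcet winner and `τ` the last detection time. -/
structure ArmOrder (K : ℕ) where
  arm : ℕ → Fin K → ℕ → Fin K
  bijOn : ∀ τ I, Set.BijOn (arm τ I) (Set.Iio (K - 1)) {j | j ≠ I}

/-- The parameters of DETECT: the number `capT` of time steps for which the black-box algorithm is
run, the window length `w`, the threshold `b`, the black-box algorithm and the orderings. -/
structure Detect (K : ℕ) where
  capT : ℕ
  w : ℕ
  b : ℝ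
  alg : BlackBox K
  ord : ArmOrder K

/-- The internal state of DETECT. The number `τ` is the time step of the last detection.
In the running phase, `h` contains the duels of the current instance of the black-box algorithm
(most recent first). In a detection phase, `I` is the suspected Condorcet winner and `X j` contains
the outcomes of all duels between `a_I` and `a_j` in this phase (most recent first). -/
inductive DetectState (K : ℕ) : Type
  | running (τ : ℕ) (h : List (Duel K))
  | detecting (τ : ℕ) (I : Fin K) (X : Fin K → List Bool)

namespace Detect

variable {K : ℕ} (D : Detect K)

/-- The changepoint test on the outcomes of one pair (most recent first): there are at least `w`
outcomes, and among the last `w` outcomes the numbers of wins in the older and in the newer half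
differ by more than `b`. -/
def alarm (X : List Bool) : Prop :=
  D.w ≤ X.length ∧
    D.b < |((((X.drop (D.w / 2)).take (D.w / 2)).count true : ℕ) : ℝ)
      - (((X.take (D.w / 2)).count true : ℕ) : ℝ)|

open Classical in
/-- A detection step at time `t` under the preference matrix `Q`: the joint law of the played pair
and the next state. -/
def detectionStep (Q : Fin K → Fin K → unitInterval) (t τ : ℕ) (I : Fin K)
    (X : Fin K → List Bool) : PMF (ArmPair K × DetectState K) :=
  let J : Fin K := D.ord.arm τ I ((t - τ - D.capT - 1) % (K - 1))
  (bernoulli (Q I J)).map fun x =>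
    ((I, J),
      if D.alarm (x :: X J) then DetectState.running t []
      else DetectState.detecting τ I (Function.update X J (x :: X J)))

/-- Time step `t` of DETECT under the preference matrix `Q`: the joint law of the played pair and
the next state, given the current state. -/
def step (Q : Fin K → Fin K → unitInterval) (t : ℕ) :
    DetectState K → PMF (ArmPair K × DetectState K)
  | DetectState.running τ h =>
      if t - τ ≤ D.capT then
        (D.alg.duel Q h).map fun x => (x.1, DetectState.running τ (x :: h))
      else
        (D.alg.suspect h).bind fun I => D.detectionStep Q t τ I fun _ => []
  | DetectState.detecting τ I X => D.detectionStep Q t τ I X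

/-- The joint law of the pairs (most recent first) that DETECT plays in the time steps `1, …, n`
and of its state afterwards, where `Q t` is the preference matrix of time step `t`. -/
def run (Q : ℕ → Fin K → Fin K → unitInterval) :
    ℕ → PMF (List (ArmPair K) × DetectState K)
  | 0 => PMF.pure ([], DetectState.running 0 [])
  | n + 1 => (run Q n).bind fun s =>
      (D.step (Q (n + 1)) (n + 1) s.2).map fun r => (r.1 :: s.1, r.2)

/-- The expected cumulative binary weak regret of DETECT up to the time horizon. -/
def expRegret {M T : ℕ} (E : Environment K M T) : ℝ :=
  expect (D.run E.prefAt T) fun s => E.cumRegret 1 s.1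

end Detect

end DuelingBandits

end

/-!
The quantity to bound is the cost to go: the expected future regret given the current state of
DETECT. If alarms are ignored, the outcomes of each pair in a detection phase are independent
Bernoulli variables, and Hoeffding's inequality bounds by `2 / T ^ 4` both the probability that a
window inside one segment raises an alarm and the probability that no alarm is raised by a window
whose two halves lie on different sides of a changepoint that moves the winning probability by at
least `4 b / w`.

Suppose that a cycle starts at most `(K - 1) w / 2` steps after the beginning of a segment. The run
of the black-box algorithm costs its own regret, and a wrong suspected winner, which has probability
at most `1 - p`, costs at most `T`. The right one plays without regret up to the next changepoint
unless there is a false alarm. After that changepoint, `(K - 1) w / 2` steps give `w / 2` new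
outcomes of every pair, so that the pair whose winning probability has changed raises an alarm by
then, and the next cycle again starts early in its segment. Backward induction over the segments
adds up these costs.
-/

open scoped ENNReal

noncomputable section

namespace DuelingBandits

section lexpect

variable {α β : Type}

/-- The `ℝ≥0∞`-valued expected value of `F` under the discrete probability distribution `μ`: the
counterpart of `expect` that needs no summability. -/
def lexpect (μ : PMF α) (F : α → ℝ≥0∞) : ℝ≥0∞ := ∑' a, μ a * F a

theorem lexpect_pure (a : α) (F : α → ℝ≥0∞) : lexpect (PMF.pure a) F = F a := by
  classical
  simp [lexpect, PMF.pure_apply, ite_mul]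

theorem lexpect_bind (μ : PMF α) (k : α → PMF β) (F : β → ℝ≥0∞) :
    lexpect (μ.bind k) F = lexpect μ fun a => lexpect (k a) F := by
  simp only [lexpect, PMF.bind_apply, ← ENNReal.tsum_mul_right, ← ENNReal.tsum_mul_left]
  rw [ENNReal.tsum_comm]
  simp only [mul_assoc]

theorem lexpect_map (μ : PMF α) (f : α → β) (F : β → ℝ≥0∞) :
    lexpect (μ.map f) F = lexpect μ fun a => F (f a) := by
  simp only [PMF.map, lexpect_bind, Function.comp_apply, lexpect_pure]

theorem lexpect_mono_support {μ : PMF α} {F G : α → ℝ≥0∞} (h : ∀ a ∈ μ.support, F a ≤ G a) :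
    lexpect μ F ≤ lexpect μ G := by
  refine ENNReal.tsum_le_tsum fun a => ?_
  by_cases ha : μ a = 0
  · simp only [ha, zero_mul, le_refl]
  · gcongr
    exact h a ha

theorem lexpect_mono (μ : PMF α) {F G : α → ℝ≥0∞} (h : ∀ a, F a ≤ G a) :
    lexpect μ F ≤ lexpect μ G :=
  lexpect_mono_support fun a _ => h a

theorem lexpect_congr_support {μ : PMF α} {F G : α → ℝ≥0∞} (h : ∀ a ∈ μ.support, F a = G a) :
    lexpect μ F = lexpect μ G :=
  le_antisymm (lexpect_mono_support fun a ha => (h a ha).le)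
    (lexpect_mono_support fun a ha => (h a ha).ge)

theorem lexpect_const (μ : PMF α) (c : ℝ≥0∞) : lexpect μ (fun _ => c) = c := by
  rw [lexpect, ENNReal.tsum_mul_right, PMF.tsum_coe, one_mul]

theorem lexpect_add (μ : PMF α) (F G : α → ℝ≥0∞) :
    lexpect μ (fun a => F a + G a) = lexpect μ F + lexpect μ G := by
  simp only [lexpect, mul_add, ENNReal.tsum_add]

theorem lexpect_const_add (μ : PMF α) (c : ℝ≥0∞) (F : α → ℝ≥0∞) :
    lexpect μ (fun a => c + F a) = c + lexpect μ F := by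
  rw [lexpect_add, lexpect_const]

theorem lexpect_mul_const (μ : PMF α) (F : α → ℝ≥0∞) (c : ℝ≥0∞) :
    lexpect μ (fun a => F a * c) = lexpect μ F * c := by
  simp only [lexpect, ← mul_assoc, ENNReal.tsum_mul_right]

theorem lexpect_const_mul (μ : PMF α) (c : ℝ≥0∞) (F : α → ℝ≥0∞) :
    lexpect μ (fun a => c * F a) = c * lexpect μ F := by
  simp only [mul_comm c, lexpect_mul_const]

theorem lexpect_indicator_const (μ : PMF α) (s : Set α) (c : ℝ≥0∞) :
    lexpect μ (s.indicator fun _ => c) = μ.toOuterMeasure s * c := by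
  rw [PMF.toOuterMeasure_apply, ← ENNReal.tsum_mul_right, lexpect]
  refine tsum_congr fun a => ?_
  by_cases ha : a ∈ s <;> simp [ha]

theorem lexpect_le_const {μ : PMF α} {F : α → ℝ≥0∞} {c : ℝ≥0∞} (h : ∀ a ∈ μ.support, F a ≤ c) :
    lexpect μ F ≤ c :=
  (lexpect_mono_support h).trans_eq (lexpect_const μ c)

theorem expect_eq_toReal_lexpect (μ : PMF α) {f : α → ℝ} (hf : ∀ a, 0 ≤ f a) :
    expect μ f = (lexpect μ fun a => ENNReal.ofReal (f a)).toReal := by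
  rw [lexpect, ENNReal.tsum_toReal_eq fun a => ENNReal.mul_ne_top (μ.apply_ne_top a)
    ENNReal.ofReal_ne_top]
  simp only [expect, ENNReal.toReal_mul, ENNReal.toReal_ofReal (hf _)]

end lexpect

section concentration

variable {α : Type} {μ : PMF α} {X : α → ℝ} {v a : ℝ}

theorem toOuterMeasure_le_of_lexpect_exp_le
    (hX : ∀ s : ℝ, lexpect μ (fun x => ENNReal.ofReal (Real.exp (s * X x)))
      ≤ ENNReal.ofReal (Real.exp (v * s ^ 2 / 2)))
    (hv : 0 < v) (ha : 0 ≤ a) :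
    μ.toOuterMeasure {x | a ≤ X x} ≤ ENNReal.ofReal (Real.exp (-(a ^ 2 / (2 * v)))) := by
  have hmarkov : ∀ x, {x | a ≤ X x}.indicator (fun _ => (1 : ℝ≥0∞)) x
      ≤ ENNReal.ofReal (Real.exp (a / v * X x)) * ENNReal.ofReal (Real.exp (-(a / v * a))) := by
    refine Set.indicator_le fun x (hx : a ≤ X x) => ?_
    rw [← ENNReal.ofReal_mul (Real.exp_nonneg _), ← Real.exp_add, ENNReal.one_le_ofReal,
      Real.one_le_exp_iff, ← sub_eq_add_neg, ← mul_sub]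
    exact mul_nonneg (div_nonneg ha hv.le) (sub_nonneg.2 hx)
  calc μ.toOuterMeasure {x | a ≤ X x}
      = lexpect μ ({x | a ≤ X x}.indicator fun _ => 1) := by
        rw [lexpect_indicator_const, mul_one]
    _ ≤ lexpect μ (fun x => ENNReal.ofReal (Real.exp (a / v * X x)))
          * ENNReal.ofReal (Real.exp (-(a / v * a))) :=
        (lexpect_mono μ hmarkov).trans_eq (lexpect_mul_const ..)
    _ ≤ ENNReal.ofReal (Real.exp (v * (a / v) ^ 2 / 2))
          * ENNReal.ofReal (Real.exp (-(a / v * a))) := by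
        gcongr
        exact hX _
    _ = ENNReal.ofReal (Real.exp (-(a ^ 2 / (2 * v)))) := by
        rw [← ENNReal.ofReal_mul (Real.exp_nonneg _), ← Real.exp_add]
        congr 2
        field_simp
        ring

theorem toOuterMeasure_abs_le_of_lexpect_exp_le
    (hX : ∀ s : ℝ, lexpect μ (fun x => ENNReal.ofReal (Real.exp (s * X x)))
      ≤ ENNReal.ofReal (Real.exp (v * s ^ 2 / 2)))
    (hv : 0 < v) (ha : 0 ≤ a) :
    μ.toOuterMeasure {x | a ≤ |X x|} ≤ ENNReal.ofReal (2 * Real.exp (-(a ^ 2 / (2 * v)))) := by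
  have hneg : ∀ s : ℝ, lexpect μ (fun x => ENNReal.ofReal (Real.exp (s * -X x)))
      ≤ ENNReal.ofReal (Real.exp (v * s ^ 2 / 2)) := fun s => by
    simpa only [mul_neg, neg_mul, neg_sq] using hX (-s)
  have hunion : {x | a ≤ |X x|} = {x | a ≤ X x} ∪ {x | a ≤ -X x} :=
    Set.ext fun x => le_abs (b := X x)
  rw [hunion, two_mul, ENNReal.ofReal_add (Real.exp_nonneg _) (Real.exp_nonneg _)]
  exact (MeasureTheory.measure_union_le _ _).trans
    (add_le_add (toOuterMeasure_le_of_lexpect_exp_le hX hv ha)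
      (toOuterMeasure_le_of_lexpect_exp_le hneg hv ha))

theorem integral_bernoulli (p : unitInterval) (f : Bool → ℝ) :
    ∫ x, f x ∂(bernoulli p).toMeasure = p * f true + (1 - p) * f false := by
  rw [PMF.integral_eq_sum, Fintype.sum_bool]
  simp [bernoulli, ENNReal.toReal_ofReal, p.2.1, p.2.2]

theorem lexpect_bernoulli_exp_le (p : unitInterval) (s : ℝ) :
    lexpect (bernoulli p)
        (fun x => ENNReal.ofReal (Real.exp (s * ((if x then 1 else 0) - (p : ℝ)))))
      ≤ ENNReal.ofReal (Real.exp (s ^ 2 / 8)) := by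
  have hoeffding := ProbabilityTheory.hasSubgaussianMGF_of_mem_Icc
    (μ := (bernoulli p).toMeasure) (X := fun x : Bool => if x then (1 : ℝ) else 0) (a := 0) (b := 1)
    (measurable_of_finite _).aemeasurable (.of_forall fun x => by cases x <;> simp)
  have hmgf := hoeffding.mgf_le s
  rw [ProbabilityTheory.mgf, integral_bernoulli, integral_bernoulli] at hmgf
  have h0 : (0 : ℝ) ≤ p := p.2.1
  have h1 : 0 ≤ 1 - (p : ℝ) := sub_nonneg.2 p.2.2
  rw [lexpect, tsum_fintype, Fintype.sum_bool]
  simp only [bernoulli, PMF.ofFintype_apply, if_true, Bool.false_eq_true, if_false]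
  rw [← ENNReal.ofReal_mul h0, ← ENNReal.ofReal_mul h1,
    ← ENNReal.ofReal_add (by positivity) (by positivity)]
  refine ENNReal.ofReal_le_ofReal ?_
  refine le_trans (le_of_eq ?_) (hmgf.trans_eq ?_)
  · simp
  · congr 1
    simp only [sub_zero, nnnorm_one, NNReal.coe_pow, NNReal.coe_div, NNReal.coe_one,
      NNReal.coe_ofNat]
    ring

end concentration

/-- The law of a list of independent Bernoulli outcomes with the given success probabilities. -/
def outcomeLaw : List unitInterval → PMF (List Bool)
  | [] => PMF.pure []
  | p :: ps => (outcomeLaw ps).bind fun H => (bernoulli p).map fun x => x :: H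

theorem length_of_mem_support_outcomeLaw {ps : List unitInterval} {H : List Bool}
    (hH : H ∈ (outcomeLaw ps).support) : H.length = ps.length := by
  induction ps generalizing H with
  | nil => simpa [outcomeLaw] using hH
  | cons p ps ih =>
    simp only [outcomeLaw, PMF.mem_support_bind_iff, PMF.mem_support_map_iff] at hH
    obtain ⟨H', hH', x, -, rfl⟩ := hH
    rw [List.length_cons, List.length_cons, ih hH']

theorem outcomeLaw_append (ps qs : List unitInterval) :
    outcomeLaw (ps ++ qs) = (outcomeLaw qs).bind fun H => (outcomeLaw ps).map (· ++ H) := by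
  induction ps with
  | nil => simp [outcomeLaw, PMF.pure_map, PMF.bind_pure]
  | cons p ps ih =>
    simp only [List.cons_append, outcomeLaw, ih, PMF.bind_bind, PMF.map_bind, PMF.bind_map,
      PMF.map_comp, Function.comp_def]

/-- The expected number of successes under `outcomeLaw ps`. -/
def meanCount (ps : List unitInterval) : ℝ := (ps.map ((↑) : unitInterval → ℝ)).sum

theorem meanCount_replicate (n : ℕ) (p : unitInterval) :
    meanCount (List.replicate n p) = n * p := by
  simp [meanCount]

theorem lexpect_exp_count_sub_meanCount_le (ps : List unitInterval) (s : ℝ) :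
    lexpect (outcomeLaw ps)
        (fun H => ENNReal.ofReal (Real.exp (s * (H.count true - meanCount ps))))
      ≤ ENNReal.ofReal (Real.exp (ps.length * (s ^ 2 / 8))) := by
  induction ps with
  | nil => simp [outcomeLaw, lexpect_pure, meanCount]
  | cons p ps ih =>
    have hcons : ∀ x (H : List Bool), ENNReal.ofReal
          (Real.exp (s * ((x :: H).count true - meanCount (p :: ps))))
        = ENNReal.ofReal (Real.exp (s * (H.count true - meanCount ps)))
          * ENNReal.ofReal (Real.exp (s * ((if x then 1 else 0) - (p : ℝ)))) := fun x H => by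
      rw [← ENNReal.ofReal_mul (Real.exp_nonneg _), ← Real.exp_add]
      cases x <;> simp [meanCount] <;> ring_nf
    simp only [outcomeLaw, lexpect_bind, lexpect_map, hcons, lexpect_const_mul]
    rw [lexpect_mul_const, List.length_cons, Nat.cast_succ, add_mul, one_mul, Real.exp_add,
      ENNReal.ofReal_mul (Real.exp_nonneg _)]
    exact mul_le_mul' ih (lexpect_bernoulli_exp_le p s)

/-- The statistic of the changepoint test: the number of successes in the older half of the
last `2 * h` outcomes minus the number of successes in the newer half. -/
def windowDiff (h : ℕ) (H : List Bool) : ℝ :=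
  ((H.drop h).take h).count true - (H.take h).count true

theorem windowDiff_append {h : ℕ} {H₁ H₂ : List Bool} (h₁ : H₁.length = h) (h₂ : H₂.length = h)
    (H₃ : List Bool) : windowDiff h (H₁ ++ (H₂ ++ H₃)) = H₂.count true - H₁.count true := by
  rw [windowDiff, List.drop_left' h₁, List.take_left' h₂, List.take_left' h₁]

theorem lexpect_exp_windowDiff_le {h : ℕ} {ps qs : List unitInterval}
    (hps : ps.length = h) (hqs : qs.length = h) (rs : List unitInterval) (s : ℝ) :
    lexpect (outcomeLaw (ps ++ (qs ++ rs))) (fun H => ENNReal.ofReal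
        (Real.exp (s * (windowDiff h H - (meanCount qs - meanCount ps)))))
      ≤ ENNReal.ofReal (Real.exp (h / 2 * s ^ 2 / 2)) := by
  simp only [outcomeLaw_append, lexpect_bind, lexpect_map]
  refine lexpect_le_const fun H₃ _ => ?_
  calc _ = lexpect (outcomeLaw qs) fun H₂ => lexpect (outcomeLaw ps) fun H₁ =>
          ENNReal.ofReal (Real.exp (-s * (H₁.count true - meanCount ps)))
            * ENNReal.ofReal (Real.exp (s * (H₂.count true - meanCount qs))) :=
        lexpect_congr_support fun H₂ h₂ => lexpect_congr_support fun H₁ h₁ => by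
          rw [windowDiff_append ((length_of_mem_support_outcomeLaw h₁).trans hps)
            ((length_of_mem_support_outcomeLaw h₂).trans hqs),
            ← ENNReal.ofReal_mul (Real.exp_nonneg _), ← Real.exp_add]
          ring_nf
    _ ≤ ENNReal.ofReal (Real.exp (h * ((-s) ^ 2 / 8)))
          * ENNReal.ofReal (Real.exp (h * (s ^ 2 / 8))) := by
        simp only [lexpect_mul_const, lexpect_const_mul]
        exact mul_le_mul' (hps ▸ lexpect_exp_count_sub_meanCount_le ps (-s))
          (hqs ▸ lexpect_exp_count_sub_meanCount_le qs s)
    _ = ENNReal.ofReal (Real.exp (h / 2 * s ^ 2 / 2)) := by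
        rw [← ENNReal.ofReal_mul (Real.exp_nonneg _), ← Real.exp_add]
        ring_nf

theorem toOuterMeasure_windowDiff_le {h : ℕ} (hh : 0 < h) {ps qs : List unitInterval}
    (hps : ps.length = h) (hqs : qs.length = h) (rs : List unitInterval) {a : ℝ} (ha : 0 ≤ a) :
    (outcomeLaw (ps ++ (qs ++ rs))).toOuterMeasure
        {H | a ≤ |windowDiff h H - (meanCount qs - meanCount ps)|}
      ≤ ENNReal.ofReal (2 * Real.exp (-(a ^ 2 / h))) := by
  convert toOuterMeasure_abs_le_of_lexpect_exp_le (lexpect_exp_windowDiff_le hps hqs rs)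
    (by positivity) ha using 5
  ring

namespace Environment

variable {K M T : ℕ} (E : Environment K M T)

theorem pos_of_horizon_pos (E : Environment K M T) (hT : 0 < T) : 0 < M := by
  by_contra! hM
  obtain rfl := Nat.le_zero.1 hM
  have := E.ν_zero.symm.trans E.ν_last
  omega

theorem ν_mono {i j : ℕ} (hij : i ≤ j) (hj : j ≤ M) : E.ν i ≤ E.ν j := by
  induction j, hij using Nat.le_induction with
  | base => rfl
  | succ j _ ih => exact (ih (by omega)).trans (E.ν_lt j hj).le

theorem ν_le {m : ℕ} (hm : m ≤ M) : E.ν m ≤ T + 1 :=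
  (E.ν_mono hm le_rfl).trans_eq E.ν_last

theorem one_le_seg (t : ℕ) : 1 ≤ E.seg t := Nat.le_add_right 1 _

theorem seg_le (hM : 0 < M) (t : ℕ) : E.seg t ≤ M := by
  have h := Finset.card_filter_le (Finset.Icc 1 (M - 1)) fun m => E.ν m ≤ t
  rw [Nat.card_Icc] at h
  unfold seg
  omega

theorem seg_eq {m t : ℕ} (hm : m < M) (hl : E.ν m ≤ t) (hu : t < E.ν (m + 1)) :
    E.seg t = m + 1 := by
  have hfilter : (Finset.Icc 1 (M - 1)).filter (fun i => E.ν i ≤ t) = Finset.Icc 1 m := by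
    ext i
    simp only [Finset.mem_filter, Finset.mem_Icc]
    refine ⟨fun ⟨⟨hi, hiM⟩, hit⟩ => ⟨hi, ?_⟩, fun ⟨hi, him⟩ =>
      ⟨⟨hi, by omega⟩, (E.ν_mono him hm.le).trans hl⟩⟩
    by_contra! hlt
    exact (hit.trans_lt hu).not_ge (E.ν_mono hlt (hiM.trans (Nat.sub_le M 1)))
  rw [seg, hfilter, Nat.card_Icc]
  omega

theorem prefAt_eq {m t : ℕ} (hm : m < M) (hl : E.ν m ≤ t) (hu : t < E.ν (m + 1)) :
    E.prefAt t = E.P (m + 1) := by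
  rw [prefAt, E.seg_eq hm hl hu]

section segment

variable {m : ℕ}

theorem P_self (h1 : 1 ≤ m) (hm : m ≤ M) (i : Fin K) : (E.P m i i : ℝ) = 1 / 2 := by
  linarith [E.P_add m h1 hm i i]

theorem gap_star (h1 : 1 ≤ m) (hm : m ≤ M) : E.gap m (E.star m) = 0 := by
  rw [gap, E.P_self h1 hm, sub_self]

theorem gap_nonneg (h1 : 1 ≤ m) (hm : m ≤ M) (i : Fin K) : 0 ≤ E.gap m i := by
  rcases eq_or_ne i (E.star m) with rfl | hi
  · exact (E.gap_star h1 hm).ge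
  · exact sub_nonneg.2 (E.star_beats m h1 hm i hi).le

theorem binWeakRegret_nonneg (h1 : 1 ≤ m) (hm : m ≤ M) (d : ArmPair K) :
    0 ≤ E.binWeakRegret m d :=
  Int.cast_nonneg (Int.ceil_nonneg (le_min (E.gap_nonneg h1 hm d.1) (E.gap_nonneg h1 hm d.2)))

theorem binWeakRegret_le_one (m : ℕ) (d : ArmPair K) : E.binWeakRegret m d ≤ 1 := by
  have hgap : E.gap m d.1 ≤ 1 := by
    unfold gap
    linarith [(E.P m (E.star m) d.1).2.2]
  have hceil : ⌈E.weakRegret m d⌉ ≤ 1 :=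
    Int.ceil_le.2 (((min_le_left _ _).trans hgap).trans_eq Int.cast_one.symm)
  exact (Int.cast_mono hceil).trans_eq Int.cast_one

theorem binWeakRegret_star (h1 : 1 ≤ m) (hm : m ≤ M) (j : Fin K) :
    E.binWeakRegret m (E.star m, j) = 0 := by
  rw [binWeakRegret, weakRegret, E.gap_star h1 hm, min_eq_left (E.gap_nonneg h1 hm j),
    Int.ceil_zero, Int.cast_zero]

end segment

/-- The binary weak regret at time `t` as an extended nonnegative number. -/
def regret (t : ℕ) (d : ArmPair K) : ℝ≥0∞ := ENNReal.ofReal (E.binWeakRegret (E.seg t) d)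

theorem regret_le_one (t : ℕ) (d : ArmPair K) : E.regret t d ≤ 1 :=
  ENNReal.ofReal_le_one.2 (E.binWeakRegret_le_one _ d)

theorem regret_star {m t : ℕ} (hm : m < M) (hl : E.ν m ≤ t) (hu : t < E.ν (m + 1)) (j : Fin K) :
    E.regret t (E.star (m + 1), j) = 0 := by
  rw [regret, E.seg_eq hm hl hu, E.binWeakRegret_star (Nat.le_add_left 1 m) hm, ENNReal.ofReal_zero]

theorem cumRegret_nonneg (hM : 0 < M) (s : ℕ) (h : List (ArmPair K)) : 0 ≤ E.cumRegret s h := by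
  induction h with
  | nil => exact le_rfl
  | cons d h ih => exact add_nonneg (E.binWeakRegret_nonneg (E.one_le_seg _) (E.seg_le hM _) d) ih

theorem ofReal_cumRegret_cons (hM : 0 < M) (s : ℕ) (d : ArmPair K) (h : List (ArmPair K)) :
    ENNReal.ofReal (E.cumRegret s (d :: h))
      = ENNReal.ofReal (E.cumRegret s h) + E.regret (s + h.length) d := by
  rw [add_comm]
  exact ENNReal.ofReal_add (E.binWeakRegret_nonneg (E.one_le_seg _) (E.seg_le hM _) d)
    (E.cumRegret_nonneg hM s h)

theorem cumRegret_le_length (s : ℕ) (h : List (ArmPair K)) : E.cumRegret s h ≤ h.length := by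
  induction h with
  | nil => simp [cumRegret]
  | cons d h ih =>
    rw [cumRegret, List.length_cons, Nat.cast_succ, add_comm]
    exact add_le_add ih (E.binWeakRegret_le_one _ d)

theorem cumRegret_congr {s s' : ℕ} (h : List (ArmPair K))
    (hseg : ∀ i < h.length, E.seg (s + i) = E.seg (s' + i)) :
    E.cumRegret s h = E.cumRegret s' h := by
  induction h with
  | nil => rfl
  | cons d h ih =>
    rw [cumRegret, cumRegret, hseg _ (Nat.lt_succ_self _),
      ih fun i hi => hseg i (Nat.lt_succ_of_lt hi)]

section minSegChange

variable {E} {δ : ℝ}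

theorem segChange_le_one (m : ℕ) : E.segChange m ≤ 1 := by
  have : Nonempty (Fin K) := ⟨E.star m⟩
  exact ciSup_le fun j => abs_sub_le_iff.2
    ⟨by linarith [(E.P (m + 1) (E.star m) j).2.2, (E.P m (E.star m) j).2.1],
      by linarith [(E.P (m + 1) (E.star m) j).2.1, (E.P m (E.star m) j).2.2]⟩

theorem exists_segChange_eq (m : ℕ) :
    ∃ j, |(E.P (m + 1) (E.star m) j : ℝ) - E.P m (E.star m) j| = E.segChange m := by
  have : Nonempty (Fin K) := ⟨E.star m⟩
  exact exists_eq_ciSup_of_finite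

theorem IsMinSegChange.le_one (hδ : E.IsMinSegChange δ) : δ ≤ 1 := by
  rw [IsMinSegChange] at hδ
  split_ifs at hδ
  · exact hδ.2
  · obtain ⟨m, -, rfl⟩ := hδ.1
    exact segChange_le_one m

theorem IsMinSegChange.le_segChange (hδ : E.IsMinSegChange δ) {m : ℕ} (h1 : 1 ≤ m) (hm : m < M) :
    δ ≤ E.segChange m := by
  rw [IsMinSegChange, if_neg (by omega)] at hδ
  exact hδ.2 ⟨m, ⟨h1, by omega⟩, rfl⟩

end minSegChange

end Environment

namespace BlackBox

variable {K : ℕ} (A : BlackBox K)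

theorem run_congr {Q Q' : ℕ → Fin K → Fin K → unitInterval} {s s' n : ℕ}
    (h : ∀ i < n, Q (s + i) = Q' (s' + i)) : A.run Q s n = A.run Q' s' n := by
  induction n with
  | zero => rfl
  | succ n ih => rw [run, run, ih fun i hi => h i (by omega), h n (Nat.lt_succ_self n)]

theorem length_of_mem_support_run {Q : ℕ → Fin K → Fin K → unitInterval} {s n : ℕ}
    {h : List (Duel K)} (hh : h ∈ (A.run Q s n).support) : h.length = n := by
  induction n generalizing h with
  | zero => simpa [run] using hh
  | succ n ih =>
    simp only [run, PMF.mem_support_bind_iff, PMF.mem_support_map_iff] at hh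
    obtain ⟨h', hh', x, -, rfl⟩ := hh
    rw [List.length_cons, ih hh']

theorem one_sub_suspectProb_nonneg (Q : Fin K → Fin K → unitInterval) (n : ℕ) (i : Fin K) :
    0 ≤ 1 - A.suspectProb Q n i :=
  sub_nonneg.2 (ENNReal.toReal_mono ENNReal.one_ne_top (PMF.coe_le_one _ i))

theorem lexpect_suspect_ne (Q : Fin K → Fin K → unitInterval) (n : ℕ) (i : Fin K) :
    (lexpect (A.run (fun _ => Q) 1 n) fun h => (A.suspect h).toOuterMeasure {i}ᶜ)
      = ENNReal.ofReal (1 - A.suspectProb Q n i) := by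
  set μ := (A.run (fun _ => Q) 1 n).bind A.suspect
  calc _ = μ.toOuterMeasure {i}ᶜ := (PMF.toOuterMeasure_bind_apply ..).symm
    _ = 1 - μ i := by
        rw [← PMF.toMeasure_apply_eq_toOuterMeasure,
          MeasureTheory.prob_compl_eq_one_sub (.singleton i),
          PMF.toMeasure_apply_singleton _ _ (.singleton i)]
    _ = ENNReal.ofReal (1 - A.suspectProb Q n i) := by
        rw [suspectProb, ENNReal.ofReal_sub 1 ENNReal.toReal_nonneg, ENNReal.ofReal_one,
          ENNReal.ofReal_toReal (μ.apply_ne_top i)]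

variable {M T : ℕ} (E : Environment K M T)

theorem ofReal_expRegret (hM : 0 < M) (s n : ℕ) :
    ENNReal.ofReal (A.expRegret E s n) = lexpect (A.run E.prefAt s n)
      fun h => ENNReal.ofReal (E.cumRegret s (h.map Prod.fst)) := by
  rw [expRegret, expect_eq_toReal_lexpect _ fun h => E.cumRegret_nonneg hM s _,
    ENNReal.ofReal_toReal]
  refine ne_top_of_le_ne_top (ENNReal.natCast_ne_top n) (lexpect_le_const fun h hh => ?_)
  rw [← A.length_of_mem_support_run hh, ← List.length_map (as := h) Prod.fst,
    ← ENNReal.ofReal_natCast]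
  exact ENNReal.ofReal_le_ofReal (E.cumRegret_le_length s _)

theorem expRegret_nonneg (hM : 0 < M) (s n : ℕ) : 0 ≤ A.expRegret E s n := by
  rw [expRegret, expect_eq_toReal_lexpect _ fun h => E.cumRegret_nonneg hM s _]
  exact ENNReal.toReal_nonneg

end BlackBox

theorem count_add_left_of_periodic {p : ℕ → Prop} [DecidablePred p] {a : ℕ}
    (hp : Function.Periodic p a) (n : ℕ) : Nat.count (fun i => p (n + i)) a = Nat.count p a := by
  induction n with
  | zero => simp only [zero_add]
  | succ n ih =>
    have hfirst := Nat.count_succ' (fun i => p (n + i)) a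
    simp only [Nat.count_succ, hp n, add_zero, ih] at hfirst
    simp only [add_right_comm n 1]
    exact (Nat.add_right_cancel hfirst).symm

theorem exists_count_succ_eq {p : ℕ → Prop} [DecidablePred p] {k n : ℕ}
    (h : k < Nat.count p n) : ∃ r < n, p r ∧ Nat.count p (r + 1) = k + 1 :=
  have hk := fun hf => h.trans_le (Nat.count_le_card hf n)
  ⟨Nat.nth p k, Nat.nth_lt_of_lt_count h, Nat.nth_mem k hk, Nat.count_nth_succ hk⟩

namespace Detect

variable {K M T : ℕ} (D : Detect K)

theorem length_of_mem_support_run {Q : ℕ → Fin K → Fin K → unitInterval} {n : ℕ}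
    {s : List (ArmPair K) × DetectState K} (hs : s ∈ (D.run Q n).support) : s.1.length = n := by
  induction n generalizing s with
  | zero =>
    obtain rfl : s = ([], DetectState.running 0 []) := by simpa [run] using hs
    rfl
  | succ n ih =>
    simp only [run, PMF.mem_support_bind_iff, PMF.mem_support_map_iff] at hs
    obtain ⟨s', hs', r, -, rfl⟩ := hs
    rw [List.length_cons, ih hs']

variable (E : Environment K M T)

/-- The expected regret of DETECT in the time steps `n + 1, …, T`, given its state after time
step `n`. -/
def costToGo (n : ℕ) (s : DetectState K) : ℝ≥0∞ :=
  if n < T then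
    lexpect (D.step (E.prefAt (n + 1)) (n + 1) s) fun r =>
      E.regret (n + 1) r.1 + costToGo (n + 1) r.2
  else 0
termination_by T - n

theorem costToGo_of_lt {n : ℕ} (hn : n < T) (s : DetectState K) :
    D.costToGo E n s = lexpect (D.step (E.prefAt (n + 1)) (n + 1) s) fun r =>
      E.regret (n + 1) r.1 + D.costToGo E (n + 1) r.2 := by
  rw [costToGo, if_pos hn]

theorem costToGo_of_ge {n : ℕ} (hn : T ≤ n) (s : DetectState K) : D.costToGo E n s = 0 := by
  rw [costToGo, if_neg hn.not_gt]

theorem costToGo_le_sub (n : ℕ) (s : DetectState K) : D.costToGo E n s ≤ (T - n : ℕ) := by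
  induction hk : T - n generalizing n s with
  | zero =>
    rw [D.costToGo_of_ge E (Nat.sub_eq_zero_iff_le.1 hk), Nat.cast_zero]
  | succ k ih =>
    rw [D.costToGo_of_lt E (by omega)]
    refine lexpect_le_const fun r _ => ?_
    rw [Nat.cast_succ, add_comm]
    exact add_le_add (ih _ _ (by omega)) (E.regret_le_one _ _)

theorem costToGo_le (n : ℕ) (s : DetectState K) : D.costToGo E n s ≤ T :=
  (D.costToGo_le_sub E n s).trans (Nat.cast_le.2 (Nat.sub_le T n))

theorem lexpect_run_add_costToGo (hM : 0 < M) {n : ℕ} (hn : n ≤ T) :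
    (lexpect (D.run E.prefAt n) fun s =>
        ENNReal.ofReal (E.cumRegret 1 s.1) + D.costToGo E n s.2)
      = D.costToGo E 0 (DetectState.running 0 []) := by
  induction n with
  | zero => simp [run, lexpect_pure, Environment.cumRegret]
  | succ n ih =>
    rw [← ih (Nat.le_of_succ_le hn), run, lexpect_bind]
    refine lexpect_congr_support fun s hs => ?_
    simp only [D.costToGo_of_lt E hn, lexpect_map, ← lexpect_const_add,
      E.ofReal_cumRegret_cons hM, D.length_of_mem_support_run hs, add_comm 1 n, add_assoc]

theorem expRegret_eq_costToGo (hM : 0 < M) :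
    D.expRegret E = (D.costToGo E 0 (DetectState.running 0 [])).toReal := by
  rw [expRegret, expect_eq_toReal_lexpect _ fun s => E.cumRegret_nonneg hM 1 _,
    ← D.lexpect_run_add_costToGo E hM le_rfl]
  simp only [D.costToGo_of_ge E le_rfl, add_zero]

theorem costToGo_running (hM : 0 < M) {τ n : ℕ} (hn : n ≤ D.capT) (hT : τ + n ≤ T) :
    D.costToGo E τ (DetectState.running τ [])
      = lexpect (D.alg.run E.prefAt (τ + 1) n) fun h =>
          ENNReal.ofReal (E.cumRegret (τ + 1) (h.map Prod.fst))
            + D.costToGo E (τ + n) (DetectState.running τ h) := by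
  induction n with
  | zero => simp [BlackBox.run, lexpect_pure, Environment.cumRegret]
  | succ n ih =>
    rw [ih (by omega) (by omega), BlackBox.run, lexpect_bind]
    refine lexpect_congr_support fun h hh => ?_
    have hrun : τ + n + 1 - τ ≤ D.capT := by omega
    have htime : τ + n + 1 = τ + 1 + n := add_right_comm τ n 1
    rw [D.costToGo_of_lt E (show τ + n < T by omega), step, if_pos hrun, lexpect_map, lexpect_map,
      ← lexpect_const_add, htime]
    simp only [List.map_cons, E.ofReal_cumRegret_cons hM, List.length_map,
      D.alg.length_of_mem_support_run hh, add_assoc, ← htime]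

theorem costToGo_running_eq_lexpect_suspect {τ n : ℕ} (hn : τ + D.capT ≤ n) (h : List (Duel K)) :
    D.costToGo E n (DetectState.running τ h) = lexpect (D.alg.suspect h) fun I =>
      D.costToGo E n (DetectState.detecting τ I fun _ => []) := by
  rcases lt_or_ge n T with hT | hT
  · simp only [D.costToGo_of_lt E hT, step, if_neg (show ¬ n + 1 - τ ≤ D.capT by omega),
      lexpect_bind]
  · simp only [D.costToGo_of_ge E hT, lexpect_const]

/-- The number of consecutive duels of a detection phase that contain exactly `w / 2` duels of each
pair: half a window of every pair. -/
def delay : ℕ := D.w / 2 * (K - 1)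

/-- Hoeffding's bound on the probability that the statistic of the changepoint test deviates from
its mean by at least `b`. -/
def testError : ℝ := 2 * Real.exp (-(2 * D.b ^ 2 / D.w))

theorem toOuterMeasure_deviation_le (hw : Even D.w) (hw0 : 0 < D.w) (hb : 0 ≤ D.b)
    {ps qs : List unitInterval} (hps : ps.length = D.w / 2) (hqs : qs.length = D.w / 2)
    (rs : List unitInterval) :
    (outcomeLaw (ps ++ (qs ++ rs))).toOuterMeasure
        {H | D.b ≤ |windowDiff (D.w / 2) H - (meanCount qs - meanCount ps)|}
      ≤ ENNReal.ofReal D.testError := by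
  obtain ⟨h, hh⟩ := hw
  refine (toOuterMeasure_windowDiff_le (by omega) hps hqs rs hb).trans_eq ?_
  rw [testError, Nat.cast_div_charZero ⟨h, by omega⟩, Nat.cast_ofNat, div_div_eq_mul_div,
    mul_comm (2 : ℝ) (D.b ^ 2)]

theorem toOuterMeasure_alarm_le (hw : Even D.w) (hw0 : 0 < D.w) (hb : 0 ≤ D.b) (n : ℕ)
    (p : unitInterval) :
    (outcomeLaw (List.replicate n p)).toOuterMeasure {H | D.alarm H}
      ≤ ENNReal.ofReal D.testError := by
  rcases lt_or_ge n D.w with hn | hn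
  · refine (PMF.toOuterMeasure_mono _ (t := ∅) fun H hH => ?_).trans (by simp)
    have hlen := length_of_mem_support_outcomeLaw hH.2
    rw [List.length_replicate] at hlen
    exact (hH.1.1.trans_eq hlen).not_gt hn
  · have hsplit : List.replicate n p = List.replicate (D.w / 2) p
        ++ (List.replicate (D.w / 2) p ++ List.replicate (n - 2 * (D.w / 2)) p) := by
      simp only [List.replicate_append_replicate]
      congr 1
      omega
    rw [hsplit]
    refine (MeasureTheory.measure_mono fun H hH => ?_).trans
      (D.toOuterMeasure_deviation_le hw hw0 hb List.length_replicate List.length_replicate _)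
    rw [Set.mem_ofPred_eq, sub_self, sub_zero]
    exact hH.2.le

theorem toOuterMeasure_not_alarm_le (hw : Even D.w) (hw0 : 0 < D.w) (hb : 0 ≤ D.b) {n : ℕ}
    (hn : D.w / 2 ≤ n) {p q : unitInterval} (hpq : 4 * D.b ≤ D.w * |(q : ℝ) - p|) :
    (outcomeLaw (List.replicate (D.w / 2) q ++ List.replicate n p)).toOuterMeasure
        {H | ¬ D.alarm H}
      ≤ ENNReal.ofReal D.testError := by
  have hhalf : ((D.w / 2 : ℕ) : ℝ) = D.w / 2 := Nat.cast_div_charZero hw.two_dvd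
  have hsplit : List.replicate n p
      = List.replicate (D.w / 2) p ++ List.replicate (n - D.w / 2) p := by
    rw [List.replicate_append_replicate, Nat.add_sub_cancel' hn]
  refine le_trans (PMF.toOuterMeasure_mono _ fun H hH => ?_)
    (hsplit ▸ D.toOuterMeasure_deviation_le hw hw0 hb List.length_replicate List.length_replicate _)
  have hlen := length_of_mem_support_outcomeLaw hH.2
  rw [List.length_append, List.length_replicate, List.length_replicate] at hlen
  have hwindow : D.w ≤ H.length := by
    have := Nat.two_mul_div_two_of_even hw
    omega
  have hsmall : |windowDiff (D.w / 2) H| ≤ D.b := not_lt.1 fun hlt => hH.1 ⟨hwindow, hlt⟩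
  rw [Set.mem_ofPred_eq, meanCount_replicate, meanCount_replicate, hhalf, ← mul_sub]
  have hmean : |(D.w / 2 : ℝ) * ((p : ℝ) - q)| = D.w / 2 * |(q : ℝ) - p| := by
    rw [abs_mul, abs_of_nonneg (by positivity), abs_sub_comm]
  have htriangle := abs_sub_abs_le_abs_sub ((D.w / 2 : ℝ) * ((p : ℝ) - q)) (windowDiff (D.w / 2) H)
  rw [hmean, abs_sub_comm _ (windowDiff _ _)] at htriangle
  linarith

section schedule

/-- The index of the arm that `a_I` meets in the `N`-th duel (counting from zero) of the detection
phase of the cycle that starts after time step `τ`. -/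
def opponent (τ : ℕ) (I : Fin K) (N : ℕ) : Fin K := D.ord.arm τ I (N % (K - 1))

/-- The number of duels against `a_j` among the duels `n, …, n + r - 1` of a detection phase. -/
def visits (τ : ℕ) (I j : Fin K) (n r : ℕ) : ℕ :=
  Nat.count (fun i => D.opponent τ I (n + i) = j) r

variable {D} {τ : ℕ} {I j : Fin K}

theorem visits_add (n r s : ℕ) :
    D.visits τ I j n (r + s) = D.visits τ I j n r + D.visits τ I j (n + r) s := by
  simp only [visits, Nat.count_add, add_assoc]

theorem visits_period (hj : j ≠ I) (n : ℕ) : D.visits τ I j n (K - 1) = 1 := by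
  have hperiodic : Function.Periodic (fun i => D.opponent τ I i = j) (K - 1) := fun i => by
    simp only [opponent, Nat.add_mod_right]
  obtain ⟨s, hs, rfl⟩ := (D.ord.bijOn τ I).surjOn hj
  rw [visits, count_add_left_of_periodic hperiodic, Nat.count_eq_card_filter_range,
    Finset.card_eq_one]
  refine ⟨s, Finset.ext fun i => ?_⟩
  rw [Finset.mem_filter, Finset.mem_range, Finset.mem_singleton]
  constructor
  · rintro ⟨hi, hij⟩
    rw [opponent, Nat.mod_eq_of_lt hi] at hij
    exact (D.ord.bijOn τ I).injOn hi hs hij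
  · rintro rfl
    exact ⟨hs, by rw [opponent, Nat.mod_eq_of_lt hs]⟩

theorem visits_mul_period (hj : j ≠ I) (n k : ℕ) : D.visits τ I j n (k * (K - 1)) = k := by
  induction k with
  | zero => rw [zero_mul, visits, Nat.count_zero]
  | succ k ih => rw [Nat.succ_mul, visits_add, ih, visits_period hj]

end schedule

section detection

variable (τ : ℕ) (I : Fin K)

/-- The law of the outcome lists of a detection phase after its `N`-th duel, given the outcome
lists `X` before it; an alarm is ignored. -/
def trackStep (N : ℕ) (X : Fin K → List Bool) : PMF (Fin K → List Bool) :=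
  let J := D.opponent τ I N
  (bernoulli (E.prefAt (τ + D.capT + N + 1) I J)).map fun x => Function.update X J (x :: X J)

/-- The law of the outcome lists of a detection phase after the duels `N, …, N + r - 1`, given the
outcome lists `X` before them; alarms are ignored, so that the lists of distinct arms do not
influence each other. -/
def track (N : ℕ) (X : Fin K → List Bool) : ℕ → PMF (Fin K → List Bool)
  | 0 => PMF.pure X
  | r + 1 => (track N X r).bind (D.trackStep E τ I (N + r))

theorem track_add (N : ℕ) (X : Fin K → List Bool) (r s : ℕ) :
    D.track E τ I N X (r + s)
      = (D.track E τ I N X r).bind fun Y => D.track E τ I (N + r) Y s := by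
  induction s with
  | zero => exact (PMF.bind_pure _).symm
  | succ s ih =>
    rw [← add_assoc, track, ih, PMF.bind_bind, ← add_assoc]
    rfl

theorem track_one (N : ℕ) (X : Fin K → List Bool) :
    D.track E τ I N X 1 = D.trackStep E τ I N X :=
  PMF.pure_bind _ _

/-- The winning probabilities of `a_I` in its duels against `a_j` among the first `N` duels of a
detection phase (most recent first). -/
def winProbs (j : Fin K) : ℕ → List unitInterval
  | 0 => []
  | N + 1 => if D.opponent τ I N = j then E.prefAt (τ + D.capT + N + 1) I j :: winProbs j N
      else winProbs j N

variable {τ I}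

theorem winProbs_add {j : Fin K} {Q : Fin K → Fin K → unitInterval} (n r : ℕ)
    (hQ : ∀ i < r, E.prefAt (τ + D.capT + (n + i) + 1) = Q) :
    D.winProbs E τ I j (n + r)
      = List.replicate (D.visits τ I j n r) (Q I j) ++ D.winProbs E τ I j n := by
  induction r with
  | zero => rw [visits, Nat.count_zero]; rfl
  | succ r ih =>
    rw [← add_assoc, winProbs, ih fun i hi => hQ i (by omega), visits, visits, Nat.count_succ,
      hQ r (Nat.lt_succ_self r)]
    split_ifs <;> rfl

theorem map_track (j : Fin K) (N : ℕ) :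
    (D.track E τ I 0 (fun _ => []) N).map (fun X => X j) = outcomeLaw (D.winProbs E τ I j N) := by
  induction N with
  | zero => rw [track, PMF.pure_map, winProbs, outcomeLaw]
  | succ N ih =>
    simp only [track, trackStep, zero_add, PMF.map_bind, PMF.map_comp, Function.comp_def, winProbs]
    split_ifs with hj
    · subst hj
      simp only [Function.update_self, outcomeLaw, ← ih, PMF.bind_map, Function.comp_def]
    · simp only [Function.update_of_ne (Ne.symm hj), ← ih]
      simp only [PMF.map, Function.comp_def, PMF.bind_const]

theorem toOuterMeasure_track (j : Fin K) (N : ℕ) (s : Set (List Bool)) :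
    (D.track E τ I 0 (fun _ => []) N).toOuterMeasure {X | X j ∈ s}
      = (outcomeLaw (D.winProbs E τ I j N)).toOuterMeasure s := by
  rw [← D.map_track E, PMF.toOuterMeasure_map_apply]
  rfl

open Classical in
theorem costToGo_detecting {N : ℕ} (hN : τ + D.capT + N < T) (X : Fin K → List Bool) :
    D.costToGo E (τ + D.capT + N) (DetectState.detecting τ I X)
      = lexpect (D.trackStep E τ I N X) fun Y =>
          E.regret (τ + D.capT + N + 1) (I, D.opponent τ I N)
            + if D.alarm (Y (D.opponent τ I N)) then
                D.costToGo E (τ + D.capT + N + 1) (DetectState.running (τ + D.capT + N + 1) [])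
              else D.costToGo E (τ + D.capT + N + 1) (DetectState.detecting τ I Y) := by
  have hJ : D.ord.arm τ I ((τ + D.capT + N + 1 - τ - D.capT - 1) % (K - 1))
      = D.opponent τ I N := by
    rw [opponent, show τ + D.capT + N + 1 - τ - D.capT - 1 = N by omega]
  simp only [D.costToGo_of_lt E hN, step, detectionStep, hJ, trackStep, lexpect_map,
    Function.update_self, apply_ite (D.costToGo E _)]

theorem costToGo_detecting_le_of_regret_eq_zero {n : ℕ} {ε : ℝ≥0∞} (hn : τ + D.capT + n ≤ T)
    (hreg : ∀ N < n, ∀ j, E.regret (τ + D.capT + N + 1) (I, j) = 0)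
    (hε : ∀ N < n, (D.track E τ I 0 (fun _ => []) (N + 1)).toOuterMeasure
      {X | D.alarm (X (D.opponent τ I N))} ≤ ε) :
    D.costToGo E (τ + D.capT) (DetectState.detecting τ I fun _ => [])
      ≤ n * (ε * T) + lexpect (D.track E τ I 0 (fun _ => []) n) fun X =>
          D.costToGo E (τ + D.capT + n) (DetectState.detecting τ I X) := by
  induction n with
  | zero => simp [track, lexpect_pure]
  | succ n ih =>
    set A := {X : Fin K → List Bool | D.alarm (X (D.opponent τ I n))}
    have hstep : ∀ X, D.costToGo E (τ + D.capT + n) (DetectState.detecting τ I X)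
        ≤ lexpect (D.trackStep E τ I n X) fun Y => A.indicator (fun _ => (T : ℝ≥0∞)) Y
            + D.costToGo E (τ + D.capT + n + 1) (DetectState.detecting τ I Y) := fun X => by
      rw [D.costToGo_detecting E hn]
      refine lexpect_mono _ fun Y => ?_
      rw [hreg n n.lt_succ_self, zero_add]
      split_ifs with hY
      · rw [Set.indicator_of_mem (s := A) hY]
        exact (D.costToGo_le E _ _).trans le_self_add
      · exact le_add_self
    calc _ ≤ n * (ε * T) + lexpect (D.track E τ I 0 (fun _ => []) n) fun X =>
          D.costToGo E (τ + D.capT + n) (DetectState.detecting τ I X) :=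
          ih (by omega) (fun N hN => hreg N (by omega)) fun N hN => hε N (by omega)
      _ ≤ n * (ε * T) + lexpect (D.track E τ I 0 (fun _ => []) (n + 1)) fun Y =>
            A.indicator (fun _ => (T : ℝ≥0∞)) Y
              + D.costToGo E (τ + D.capT + n + 1) (DetectState.detecting τ I Y) := by
          rw [track, lexpect_bind, zero_add]
          gcongr
          exact lexpect_mono _ hstep
      _ ≤ n * (ε * T) + (ε * T + lexpect (D.track E τ I 0 (fun _ => []) (n + 1)) fun Y =>
            D.costToGo E (τ + D.capT + n + 1) (DetectState.detecting τ I Y)) := by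
          rw [lexpect_add, lexpect_indicator_const]
          gcongr
          exact hε n n.lt_succ_self
      _ = _ := by
          rw [← add_assoc, Nat.cast_succ, add_mul, one_mul, add_assoc _ n 1]

theorem costToGo_detecting_le_of_restart_le {r N : ℕ} {V : ℝ≥0∞} (hr : τ + D.capT + N + r < T)
    (hV : ∀ t, τ + D.capT + N < t → t ≤ τ + D.capT + N + (r + 1) →
      D.costToGo E t (DetectState.running t []) ≤ V) (X : Fin K → List Bool) :
    D.costToGo E (τ + D.capT + N) (DetectState.detecting τ I X)
      ≤ (r + 1 : ℕ) + V + (D.track E τ I N X (r + 1)).toOuterMeasure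
          {Y | ¬ D.alarm (Y (D.opponent τ I (N + r)))} * T := by
  induction r generalizing N X with
  | zero =>
    set A := {Y : Fin K → List Bool | ¬ D.alarm (Y (D.opponent τ I N))}
    rw [D.costToGo_detecting E hr, track_one, add_zero N, ← lexpect_indicator_const,
      ← lexpect_const_add, zero_add, Nat.cast_one]
    refine lexpect_mono _ fun Y => ?_
    rw [add_assoc 1]
    refine add_le_add (E.regret_le_one _ _) ?_
    split_ifs with hY
    · exact (hV _ (Nat.lt_succ_self _) le_rfl).trans le_self_add
    · rw [Set.indicator_of_mem (s := A) hY]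
      exact (D.costToGo_le E _ _).trans le_add_self
  | succ r ih =>
    set A := {Y : Fin K → List Bool | ¬ D.alarm (Y (D.opponent τ I (N + (r + 1))))}
    have hcontinue : ∀ Y, D.costToGo E (τ + D.capT + N + 1) (DetectState.detecting τ I Y)
        ≤ (r + 1 : ℕ) + V + (D.track E τ I (N + 1) Y (r + 1)).toOuterMeasure A * T := fun Y => by
      have := ih (N := N + 1) (by omega) (fun t ht ht' => hV t (by omega) (by omega)) Y
      rwa [add_right_comm N 1 r] at this
    calc _ ≤ lexpect (D.trackStep E τ I N X) fun Y => 1 + ((r + 1 : ℕ) + V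
            + (D.track E τ I (N + 1) Y (r + 1)).toOuterMeasure A * T) := by
          rw [D.costToGo_detecting E (by omega)]
          refine lexpect_mono _ fun Y => add_le_add (E.regret_le_one _ _) ?_
          split_ifs with hY
          · exact (hV _ (Nat.lt_succ_self _) (by omega)).trans (le_add_self.trans le_self_add)
          · exact hcontinue Y
      _ = _ := by
          rw [lexpect_const_add, lexpect_const_add, lexpect_mul_const, add_comm (r + 1) 1,
            track_add, track_one, PMF.toOuterMeasure_bind_apply, Nat.cast_add 1, Nat.cast_one]
          simp only [← add_assoc, lexpect]

end detection

/-- The parameters of DETECT fit the environment: every segment leaves time for one run of the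
black-box algorithm and two delays, and every changepoint changes some preference of the previous
Condorcet winner enough to be detected. -/
structure Admissible : Prop where
  even_w : Even D.w
  w_pos : 0 < D.w
  b_pos : 0 < D.b
  length_le : ∀ m < M, E.ν m + D.capT + 2 * D.delay ≤ E.ν (m + 1)
  exists_change : ∀ m, m + 1 < M → ∃ j, 4 * D.b ≤ D.w *
    |(E.P (m + 2) (E.star (m + 1)) j : ℝ) - E.P (m + 1) (E.star (m + 1)) j|

section segment

variable {D E} {m τ n : ℕ} {V : ℝ≥0∞}

theorem winProbs_eq_replicate {I : Fin K} (hm : m < M) (hl : E.ν m ≤ τ + D.capT + 1)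
    (hu : τ + D.capT + n < E.ν (m + 1)) (j : Fin K) :
    D.winProbs E τ I j n = List.replicate (D.visits τ I j 0 n) (E.P (m + 1) I j) := by
  have h := D.winProbs_add E (τ := τ) (I := I) (j := j) 0 n fun i hi =>
    E.prefAt_eq hm (by omega) (by omega)
  rwa [winProbs, List.append_nil, zero_add] at h

theorem Admissible.toOuterMeasure_track_alarm_le (hD : D.Admissible E) {I : Fin K} (hm : m < M)
    (hl : E.ν m ≤ τ + D.capT + 1) (hu : τ + D.capT + n < E.ν (m + 1)) (j : Fin K) :
    (D.track E τ I 0 (fun _ => []) n).toOuterMeasure {X | D.alarm (X j)}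
      ≤ ENNReal.ofReal D.testError := by
  refine (D.toOuterMeasure_track E j n {H | D.alarm H}).trans_le ?_
  rw [winProbs_eq_replicate hm hl hu]
  exact D.toOuterMeasure_alarm_le hD.even_w hD.w_pos hD.b_pos.le _ _

theorem Admissible.exists_toOuterMeasure_track_not_alarm_le (hD : D.Admissible E)
    {I j : Fin K} (hj : j ≠ I) (hm : m + 1 < M) (hl : E.ν m ≤ τ + D.capT + 1)
    (hn : τ + D.capT + n + 1 = E.ν (m + 1)) (hdelay : D.delay ≤ n)
    (hchange : 4 * D.b ≤ D.w * |(E.P (m + 2) I j : ℝ) - E.P (m + 1) I j|) :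
    ∃ r < D.delay, (D.track E τ I 0 (fun _ => []) (n + (r + 1))).toOuterMeasure
      {X | ¬ D.alarm (X (D.opponent τ I (n + r)))} ≤ ENNReal.ofReal D.testError := by
  have hhalf : 0 < D.w / 2 := Nat.div_pos (Nat.le_of_dvd hD.w_pos hD.even_w.two_dvd) two_pos
  have hlength := hD.length_le (m + 1) hm
  have hvisits := visits_mul_period (D := D) (τ := τ) hj n (D.w / 2)
  obtain ⟨r, hr, hrj, hcount⟩ := exists_count_succ_eq
    (show D.w / 2 - 1 < D.visits τ I j n D.delay by rw [delay, hvisits]; omega)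
  have hold : D.w / 2 ≤ D.visits τ I j 0 n := by
    rw [← Nat.add_sub_cancel' hdelay, visits_add, delay, visits_mul_period hj]
    exact Nat.le_add_right _ _
  -- After duel `n + r`, the window of `a_j` has one half on each side of the changepoint.
  refine ⟨r, hr, ?_⟩
  rw [hrj]
  refine (D.toOuterMeasure_track E j (n + (r + 1)) {H | ¬ D.alarm H}).trans_le ?_
  rw [D.winProbs_add E n (r + 1) fun i hi => E.prefAt_eq hm (by omega) (by omega),
    winProbs_eq_replicate (Nat.lt_of_succ_lt hm) hl (by omega), visits, hcount,
    Nat.sub_add_cancel hhalf]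
  exact D.toOuterMeasure_not_alarm_le hD.even_w hD.w_pos hD.b_pos.le hold hchange

theorem Admissible.exists_ne_star_change (hD : D.Admissible E) (hm : m + 1 < M) :
    ∃ j ≠ E.star (m + 1), 4 * D.b ≤ D.w *
      |(E.P (m + 2) (E.star (m + 1)) j : ℝ) - E.P (m + 1) (E.star (m + 1)) j| := by
  obtain ⟨j, hj⟩ := hD.exists_change m hm
  refine ⟨j, ?_, hj⟩
  rintro rfl
  rw [E.P_self (Nat.le_add_left 1 _) hm, E.P_self (Nat.le_add_left 1 m) hm.le, sub_self, abs_zero,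
    mul_zero] at hj
  linarith [hD.b_pos]

theorem Admissible.lexpect_track_costToGo_le (hD : D.Admissible E) (hm : m < M)
    (hl : E.ν m ≤ τ + D.capT + 1) (hn : τ + D.capT + n + 1 = E.ν (m + 1)) (hdelay : D.delay ≤ n)
    (hV : ∀ t, E.ν (m + 1) ≤ t → t + 1 ≤ E.ν (m + 1) + D.delay →
      D.costToGo E t (DetectState.running t []) ≤ V) :
    (lexpect (D.track E τ (E.star (m + 1)) 0 (fun _ => []) n) fun X =>
        D.costToGo E (τ + D.capT + n) (DetectState.detecting τ (E.star (m + 1)) X))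
      ≤ D.delay + V + ENNReal.ofReal D.testError * T := by
  rcases (Nat.succ_le_of_lt hm).eq_or_lt with rfl | hmM
  · have hend : T ≤ τ + D.capT + n := by
      have hlast : E.ν (m + 1) = T + 1 := E.ν_last
      omega
    simp only [D.costToGo_of_ge E hend, lexpect_const, zero_le]
  · obtain ⟨j, hj, hchange⟩ := hD.exists_ne_star_change hmM
    obtain ⟨r, hr, hmiss⟩ :=
      hD.exists_toOuterMeasure_track_not_alarm_le hj hmM hl hn hdelay hchange
    have htime : τ + D.capT + n + r < T := by
      have := hD.length_le (m + 1) hmM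
      have := E.ν_le (m := m + 1 + 1) hmM
      omega
    calc _ ≤ lexpect (D.track E τ (E.star (m + 1)) 0 (fun _ => []) n) fun X =>
          ((r + 1 : ℕ) : ℝ≥0∞) + V + (D.track E τ (E.star (m + 1)) n X (r + 1)).toOuterMeasure
            {Y | ¬ D.alarm (Y (D.opponent τ (E.star (m + 1)) (n + r)))} * T :=
          lexpect_mono _ fun X => D.costToGo_detecting_le_of_restart_le E htime
            (fun t ht ht' => hV t (by omega) (by omega)) X
      _ = ((r + 1 : ℕ) : ℝ≥0∞) + V
            + (D.track E τ (E.star (m + 1)) 0 (fun _ => []) (n + (r + 1))).toOuterMeasure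
              {Y | ¬ D.alarm (Y (D.opponent τ (E.star (m + 1)) (n + r)))} * T := by
          rw [lexpect_const_add, lexpect_mul_const, track_add, zero_add,
            PMF.toOuterMeasure_bind_apply]
          rfl
      _ ≤ _ := by
          gcongr
          exact hr

theorem Admissible.costToGo_detecting_star_le (hD : D.Admissible E) (hm : m < M)
    (hτ : E.ν m ≤ τ + 1) (hτ' : τ + 1 ≤ E.ν m + D.delay)
    (hV : ∀ t, E.ν (m + 1) ≤ t → t + 1 ≤ E.ν (m + 1) + D.delay →
      D.costToGo E t (DetectState.running t []) ≤ V) :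
    D.costToGo E (τ + D.capT) (DetectState.detecting τ (E.star (m + 1)) fun _ => [])
      ≤ D.delay + ENNReal.ofReal D.testError * (T ^ 2 + T) + V := by
  have hlength := hD.length_le m hm
  have hlast := E.ν_le (m := m + 1) hm
  obtain ⟨n, hn⟩ : ∃ n, τ + D.capT + n + 1 = E.ν (m + 1) := ⟨E.ν (m + 1) - 1 - τ - D.capT, by omega⟩
  have hstart : E.ν m ≤ τ + D.capT + 1 := by omega
  have hnT : n ≤ T := by omega
  calc _ ≤ n * (ENNReal.ofReal D.testError * T)
        + lexpect (D.track E τ (E.star (m + 1)) 0 (fun _ => []) n) fun X =>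
          D.costToGo E (τ + D.capT + n) (DetectState.detecting τ (E.star (m + 1)) X) :=
        D.costToGo_detecting_le_of_regret_eq_zero E (by omega)
          (fun N hN j => E.regret_star hm (by omega) (by omega) j) fun N hN =>
            hD.toOuterMeasure_track_alarm_le hm hstart (by omega) _
    _ ≤ T * (ENNReal.ofReal D.testError * T)
          + (D.delay + V + ENNReal.ofReal D.testError * T) := by
        gcongr
        exact hD.lexpect_track_costToGo_le hm hstart hn (by omega) hV
    _ = _ := by ring

theorem costToGo_running_le {p : ℝ} {B : ℝ≥0∞} (hm : m < M) (hτ : E.ν m ≤ τ + 1)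
    (hτ' : τ + D.capT < E.ν (m + 1))
    (hp : p ≤ D.alg.suspectProb (E.P (m + 1)) D.capT (E.star (m + 1)))
    (hB : D.costToGo E (τ + D.capT) (DetectState.detecting τ (E.star (m + 1)) fun _ => []) ≤ B) :
    D.costToGo E τ (DetectState.running τ [])
      ≤ ENNReal.ofReal (D.alg.expRegret E (E.ν m) D.capT) + (ENNReal.ofReal (1 - p) * T + B) := by
  have hM : 0 < M := Nat.zero_lt_of_lt hm
  have hlast := E.ν_le (m := m + 1) hm
  have hseg : ∀ i < D.capT, E.seg (τ + 1 + i) = m + 1 := fun i hi =>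
    E.seg_eq hm (by omega) (by omega)
  have hseg' : ∀ i < D.capT, E.seg (E.ν m + i) = m + 1 := fun i hi =>
    E.seg_eq hm (by omega) (by omega)
  have hstart : D.alg.run E.prefAt (τ + 1) D.capT = D.alg.run E.prefAt (E.ν m) D.capT :=
    D.alg.run_congr fun i hi => by
      rw [Environment.prefAt, Environment.prefAt, hseg i hi, hseg' i hi]
  have hstat : D.alg.run E.prefAt (τ + 1) D.capT = D.alg.run (fun _ => E.P (m + 1)) 1 D.capT :=
    D.alg.run_congr fun i hi => by rw [Environment.prefAt, hseg i hi]
  have hsuspect : ∀ I, D.costToGo E (τ + D.capT) (DetectState.detecting τ I fun _ => [])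
      ≤ ({E.star (m + 1)}ᶜ : Set (Fin K)).indicator (fun _ => (T : ℝ≥0∞)) I + B := fun I => by
    rcases eq_or_ne I (E.star (m + 1)) with rfl | hI
    · exact hB.trans le_add_self
    · rw [Set.indicator_of_mem (s := {E.star (m + 1)}ᶜ) hI]
      exact (D.costToGo_le E _ _).trans le_self_add
  rw [D.costToGo_running E hM le_rfl (by omega), lexpect_add]
  refine add_le_add (le_of_eq ?_) ?_
  · rw [D.alg.ofReal_expRegret E hM, ← hstart]
    refine lexpect_congr_support fun h hh => ?_
    rw [E.cumRegret_congr _ fun i hi => ?_]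
    rw [List.length_map, D.alg.length_of_mem_support_run hh] at hi
    rw [hseg i hi, hseg' i hi]
  · rw [hstat]
    simp only [D.costToGo_running_eq_lexpect_suspect E le_rfl]
    refine (lexpect_mono _ fun h => lexpect_mono _ hsuspect).trans ?_
    simp only [lexpect_add, lexpect_const, lexpect_indicator_const, lexpect_mul_const,
      D.alg.lexpect_suspect_ne]
    gcongr

theorem Admissible.costToGo_running_le_sum (hD : D.Admissible E) {p : ℝ}
    (hp : ∀ i, 1 ≤ i → i ≤ M → p ≤ D.alg.suspectProb (E.P i) D.capT (E.star i)) (hm : m ≤ M) :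
    ∀ τ, E.ν m ≤ τ + 1 → τ + 1 ≤ E.ν m + D.delay →
      D.costToGo E τ (DetectState.running τ [])
        ≤ ∑ i ∈ Finset.Ioc m M, (ENNReal.ofReal (D.alg.expRegret E (E.ν (i - 1)) D.capT)
          + (ENNReal.ofReal (1 - p) * T
            + (D.delay + ENNReal.ofReal D.testError * (T ^ 2 + T)))) := by
  induction hm using Nat.decreasingInduction with
  | self =>
    intro τ hτ _
    rw [D.costToGo_of_ge E (by have := E.ν_last; omega)]
    exact zero_le
  | of_succ m hm ih =>
    intro τ hτ hτ'
    have hlength := hD.length_le m hm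
    have hrun := costToGo_running_le hm hτ (by have := E.ν_lt m hm; omega)
      (hp (m + 1) (Nat.le_add_left 1 m) hm)
      (hD.costToGo_detecting_star_le hm hτ hτ' fun t ht ht' => ih t (by omega) (by omega))
    refine hrun.trans_eq ?_
    rw [← Finset.Icc_add_one_left_eq_Ioc m M, ← Finset.add_sum_Ioc_eq_sum_Icc hm,
      Nat.add_sub_cancel]
    ring

theorem Admissible.expRegret_le (hD : D.Admissible E) (hM : 0 < M) {p : ℝ}
    (hp : ∀ i, 1 ≤ i → i ≤ M → p ≤ D.alg.suspectProb (E.P i) D.capT (E.star i)) :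
    D.expRegret E
      ≤ M * (D.delay + D.testError * (T ^ 2 + T)) + (1 - p) * M * T
        + ∑ i ∈ Finset.Icc 1 M, D.alg.expRegret E (E.ν (i - 1)) D.capT := by
  have hp1 : 0 ≤ 1 - p :=
    (D.alg.one_sub_suspectProb_nonneg _ _ _).trans (sub_le_sub_left (hp 1 le_rfl hM) 1)
  have hε : 0 ≤ D.testError := by unfold testError; positivity
  have halg (i : ℕ) : 0 ≤ D.alg.expRegret E (E.ν (i - 1)) D.capT :=
    D.alg.expRegret_nonneg E hM _ _
  have hbound := hD.costToGo_running_le_sum hp (Nat.zero_le M) 0 E.ν_zero.le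
    (by rw [E.ν_zero]; omega)
  rw [D.expRegret_eq_costToGo E hM]
  refine (ENNReal.toReal_mono (ENNReal.sum_ne_top.2 fun i _ => by finiteness) hbound).trans_eq ?_
  rw [ENNReal.toReal_sum fun i _ => by finiteness]
  have hterm (i : ℕ) : (ENNReal.ofReal (D.alg.expRegret E (E.ν (i - 1)) D.capT)
      + (ENNReal.ofReal (1 - p) * T
        + (D.delay + ENNReal.ofReal D.testError * (T ^ 2 + T)))).toReal
      = D.alg.expRegret E (E.ν (i - 1)) D.capT
        + ((1 - p) * T + (D.delay + D.testError * (T ^ 2 + T))) := by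
    have hT : ((T : ℝ≥0∞) ^ 2 + T).toReal = T ^ 2 + T := mod_cast ENNReal.toReal_natCast (T ^ 2 + T)
    rw [ENNReal.toReal_add (by finiteness) (by finiteness),
      ENNReal.toReal_add (by finiteness) (by finiteness),
      ENNReal.toReal_add (by finiteness) (by finiteness), ENNReal.toReal_mul, ENNReal.toReal_mul,
      ENNReal.toReal_ofReal (halg i), ENNReal.toReal_ofReal hp1, ENNReal.toReal_ofReal hε, hT,
      ENNReal.toReal_natCast, ENNReal.toReal_natCast]
  simp only [hterm]
  rw [← Finset.Icc_add_one_left_eq_Ioc, zero_add, Finset.sum_add_distrib, Finset.sum_const,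
    Nat.card_Icc, Nat.add_sub_cancel, nsmul_eq_mul]
  ring
end segment

end Detect

theorem half_lt_log {x : ℝ} (hx : 2 ≤ x) : 1 / 2 < Real.log x :=
  calc (1 : ℝ) / 2 < Real.log 2 := by linarith [Real.log_two_gt_d9]
    _ ≤ Real.log x := Real.log_le_log two_pos hx

theorem cast_le_add_two_of_isLeast_even {x : ℝ} {w : ℕ}
    (hw : IsLeast {n : ℕ | Even n ∧ x ≤ n} w) (hx : 0 ≤ x) : (w : ℝ) ≤ x + 2 := by
  by_contra! hlt
  have hw2 : 2 ≤ w := by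
    have : (2 : ℝ) < w := by linarith
    exact_mod_cast this.le
  have hmem : w - 2 ∈ {n : ℕ | Even n ∧ x ≤ n} := by
    refine ⟨hw.1.1.tsub even_two, ?_⟩
    rw [Nat.cast_sub hw2]
    push_cast
    linarith
  have hle : w ≤ w - 2 := hw.2 hmem
  omega

theorem sqrt_eq_two_mul_threshold_div {w l b : ℝ} (hw : 0 < w) (hl : 0 ≤ l)
    (hb : b = √(2 * w * l)) : √(8 * l / w) = 2 * b / w := by
  rw [hb, Real.sqrt_eq_iff_mul_self_eq (by positivity) (by positivity), ← pow_two, div_pow,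
    mul_pow, Real.sq_sqrt (by positivity)]
  field_simp
  ring

theorem four_mul_threshold_le {w l b δ : ℝ} (hl : 0 ≤ l) (hδ : 0 < δ) (hw : 0 < w)
    (hwl : 32 * l / δ ^ 2 ≤ w) (hb : b = √(2 * w * l)) : 4 * b ≤ w * δ := by
  have hsq : (4 * b) ^ 2 ≤ (w * δ) ^ 2 :=
    calc (4 * b) ^ 2 = w * (32 * l) := by rw [mul_pow, hb, Real.sq_sqrt (by positivity)]; ring
      _ ≤ w * (w * δ ^ 2) :=
        mul_le_mul_of_nonneg_left ((div_le_iff₀ (by positivity)).1 hwl) hw.le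
      _ = (w * δ) ^ 2 := by ring
  exact (pow_le_pow_iff_left₀ (by rw [hb]; positivity) (by positivity) two_ne_zero).1 hsq

theorem Detect.testError_eq {K : ℕ} {D : Detect K} {x : ℝ} (hw : 0 < D.w) (hx : 1 ≤ x)
    (hb : D.b = √(2 * D.w * Real.log x)) : D.testError = 2 / x ^ 4 := by
  have hexponent : 2 * D.b ^ 2 / D.w = (4 : ℕ) * Real.log x := by
    have := Real.log_nonneg hx
    rw [hb, Real.sq_sqrt (by positivity)]
    field_simp
    ring
  rw [testError, hexponent, Real.exp_neg, Real.exp_nat_mul, Real.exp_log (by linarith),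
    div_eq_mul_inv]

theorem Detect.testError_mul_le_one {K : ℕ} {D : Detect K} {x : ℝ} (hw : 0 < D.w) (hx : 2 ≤ x)
    (hb : D.b = √(2 * D.w * Real.log x)) : D.testError * (x ^ 2 + x) ≤ 1 := by
  rw [testError_eq hw (one_le_two.trans hx) hb, div_mul_eq_mul_div, div_le_one (by positivity)]
  calc 2 * (x ^ 2 + x) ≤ 2 * (x ^ 2 + x ^ 2) := by nlinarith
    _ = 2 ^ 2 * x ^ 2 := by ring
    _ ≤ x ^ 2 * x ^ 2 := by gcongr
    _ = x ^ 4 := by ring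

theorem Detect.cast_delay {K : ℕ} {D : Detect K} (hw : Even D.w) (hK : 1 ≤ K) :
    (D.delay : ℝ) = D.w / 2 * (K - 1) := by
  rw [delay, Nat.cast_mul, Nat.cast_div_charZero hw.two_dvd, Nat.cast_sub hK, Nat.cast_ofNat,
    Nat.cast_one]

theorem Detect.delay_add_one_le {K : ℕ} {D : Detect K} {l δ : ℝ} (hw : Even D.w) (hK : 1 ≤ K)
    (hl : 1 / 2 ≤ l) (hδ0 : 0 < δ) (hδ1 : δ ≤ 1) (hwl : (D.w : ℝ) ≤ 32 * l / δ ^ 2 + 2) :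
    (D.delay : ℝ) + 1 ≤ 18 * (K * l / δ ^ 2) := by
  have hK' : (1 : ℝ) ≤ K := by exact_mod_cast hK
  have hratio : 1 / 2 ≤ l / δ ^ 2 :=
    hl.trans (le_div_self (by linarith) (by positivity) (pow_le_one₀ hδ0.le hδ1))
  calc (D.delay : ℝ) + 1 = D.w / 2 * (K - 1) + 1 := by rw [cast_delay hw hK]
    _ ≤ (32 * l / δ ^ 2 + 2) / 2 * (K - 1) + 1 := by gcongr
    _ = 16 * (l / δ ^ 2) * (K - 1) + K := by ring
    _ ≤ 16 * (l / δ ^ 2) * K + 2 * (l / δ ^ 2) * K := by nlinarith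
    _ = 18 * (K * l / δ ^ 2) := by ring

theorem Detect.admissible {K M T : ℕ} {E : Environment K M T} {D : Detect K} {δ : ℝ}
    (hw : Even D.w) (hw0 : 0 < D.w) (hb : 0 < D.b) (hK : 1 ≤ K) (hδ : E.IsMinSegChange δ)
    (hbδ : 4 * D.b ≤ D.w * δ)
    (hlen : ∀ m, 1 ≤ m → m ≤ M → (D.capT : ℝ) + D.w * ((K : ℝ) - 1) ≤ E.ν m - E.ν (m - 1)) :
    D.Admissible E where
  even_w := hw
  w_pos := hw0
  b_pos := hb
  length_le m hm := by
    have := hlen (m + 1) (Nat.le_add_left 1 m) hm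
    rw [Nat.add_sub_cancel] at this
    have hreal : (E.ν m : ℝ) + D.capT + 2 * D.delay ≤ E.ν (m + 1) := by
      rw [cast_delay hw hK]
      linarith
    exact_mod_cast hreal
  exists_change m hm := by
    obtain ⟨j, hj⟩ := E.exists_segChange_eq (m + 1)
    refine ⟨j, hbδ.trans ?_⟩
    rw [hj]
    gcongr
    exact hδ.le_segChange (Nat.le_add_left 1 m) hm

end DuelingBandits

end

theorem corollary2_general {K M T : ℕ} (E : DuelingBandits.Environment K M T)
    (D : DuelingBandits.Detect K) {c δ p : ℝ} (hT : 2 ≤ T) (hδ : E.IsMinSegChange δ)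
    (hδ0 : 0 < δ) (hb : D.b = Real.sqrt (2 * (D.w : ℝ) * Real.log (T : ℝ)))
    (hc : c = Real.sqrt (8 * Real.log (T : ℝ) / (D.w : ℝ)))
    (hw : IsLeast {n : ℕ | Even n ∧ 32 * Real.log (T : ℝ) / δ ^ 2 ≤ (n : ℝ)} D.w)
    (hlen : ∀ m, 1 ≤ m → m ≤ M →
      (D.capT : ℝ) + (D.w : ℝ) * ((K : ℝ) - 1) ≤ (E.ν m : ℝ) - (E.ν (m - 1) : ℝ))
    (hp : ∀ m, 1 ≤ m → m ≤ M → p ≤ D.alg.suspectProb (E.P m) D.capT (E.star m)) :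
    (0 < D.b ∧ 0 < c ∧ 2 * D.b / (D.w : ℝ) + c ≤ δ) ∧
    D.expRegret E ≤
      18 * ((K : ℝ) * (M : ℝ) * Real.log (T : ℝ) / δ ^ 2)
        + (1 - p) * (M : ℝ) * (T : ℝ)
        + ∑ m ∈ Finset.Icc 1 M, D.alg.expRegret E (E.ν (m - 1)) D.capT := by
  have hM : 0 < M := E.pos_of_horizon_pos (by omega)
  have hK : 1 ≤ K := Fin.pos_iff_nonempty.2 ⟨E.star 0⟩
  have hT' : (2 : ℝ) ≤ T := by exact_mod_cast hT
  have hlog := DuelingBandits.half_lt_log hT'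
  have hlog0 : 0 < Real.log T := by linarith
  have hw0 : (0 : ℝ) < D.w := lt_of_lt_of_le (by positivity) hw.1.2
  have hb0 : 0 < D.b := by rw [hb]; positivity
  have hcb : c = 2 * D.b / D.w :=
    hc.trans (DuelingBandits.sqrt_eq_two_mul_threshold_div hw0 hlog0.le hb)
  have hbδ := DuelingBandits.four_mul_threshold_le hlog0.le hδ0 hw0 hw.1.2 hb
  have hD : D.Admissible E :=
    DuelingBandits.Detect.admissible hw.1.1 (by exact_mod_cast hw0) hb0 hK hδ hbδ hlen
  refine ⟨⟨hb0, by rw [hcb]; positivity, ?_⟩, (hD.expRegret_le hM hp).trans ?_⟩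
  · rw [hcb, ← add_div, div_le_iff₀ hw0]
    linarith
  · have herror := DuelingBandits.Detect.testError_mul_le_one (by exact_mod_cast hw0) hT' hb
    have hdelay := DuelingBandits.Detect.delay_add_one_le hw.1.1 hK hlog.le hδ0 hδ.le_one
      (DuelingBandits.cast_le_add_two_of_isLeast_even hw (by positivity))
    refine add_le_add_left (add_le_add_left ?_ _) _
    calc (M : ℝ) * (D.delay + D.testError * ((T : ℝ) ^ 2 + T))
        ≤ M * (18 * (K * Real.log T / δ ^ 2)) := by gcongr; linarith
      _ = 18 * (K * M * Real.log T / δ ^ 2) := by ring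

theorem corollary2 :
    ∃ C : ℝ, 0 < C ∧
      ∀ (K M T : ℕ) (E : DuelingBandits.Environment K M T) (D : DuelingBandits.Detect K)
        (c δ p : ℝ),
        2 ≤ K → 2 ≤ T →
        -- `δ` is the minimal segmental change, and it is positive
        E.IsMinSegChange δ → 0 < δ →
        -- the choice of the parameters
        D.b = Real.sqrt (2 * (D.w : ℝ) * Real.log (T : ℝ)) →
        c = Real.sqrt (8 * Real.log (T : ℝ) / (D.w : ℝ)) →
        IsLeast {n : ℕ | Even n ∧ 32 * Real.log (T : ℝ) / δ ^ 2 ≤ (n : ℝ)} D.w →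
        -- every segment has length at least `capT + (3 / 2) * w * (K - 1)`
        (∀ m, 1 ≤ m → m ≤ M →
          (D.capT : ℝ) + 3 / 2 * ((D.w : ℝ) * ((K : ℝ) - 1)) ≤
            (E.ν m : ℝ) - (E.ν (m - 1) : ℝ)) →
        -- `p` bounds the identification probabilities of the black-box algorithm from below
        (∀ m, 1 ≤ m → m ≤ M → p ≤ D.alg.suspectProb (E.P m) D.capT (E.star m)) →
        (0 < D.b ∧ 0 < c ∧ 2 * D.b / (D.w : ℝ) + c ≤ δ) ∧
        D.expRegret E ≤
          C * ((K : ℝ) * (M : ℝ) * Real.log (T : ℝ) / δ ^ 2)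
            + (1 - p) * (M : ℝ) * (T : ℝ)
            + ∑ m ∈ Finset.Icc 1 M, D.alg.expRegret E (E.ν (m - 1)) D.capT := by
  refine ⟨18, by norm_num, fun K M T E D c δ p hK hT hδ hδ0 hb hc hw hlen hp =>
    corollary2_general E D hT hδ hδ0 hb hc hw (fun m h1 hm => ?_) hp⟩
  have hK' : (2 : ℝ) ≤ K := by exact_mod_cast hK
  have hwK : 0 ≤ (D.w : ℝ) * (K - 1) := mul_nonneg (Nat.cast_nonneg _) (by linarith)
  linarith [hlen m h1 hm]
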